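/- Let $\tau\in\mathbb C$ with $\operatorname{Im}\tau>0$, let $\Lambda=\mathbb Z+\mathbb Z\tau$ and let $E=\mathbb C/\Lambda$ be the elliptic curve with coordinate $z=y^2+\tau y^1$, where $(y^1,y^2)$ are real coordinates in which $\Lambda$ is the standard lattice. Equip $E$ with the Kähler form $\omega_0=dy^1\wedge dy^2$ and the corresponding flat metric $g_0=|dz|^2/\operatorname{Im}\tau$. Let $q_1,\dots,q_n\in E$ be distinct points with lifts $\tilde q_1,\dots,\tilde q_n\in\mathbb C$. For $q\in E$ with lift $\tilde q$, let $L_q$ be the trivial line bundle with holomorphic structure $\bar\partial-\frac{\pi\tilde q}{\operatorname{Im}\tau}\,d\bar z$. Thus $\mathcal E_0=L_{q_1}\oplus\cdots\oplus L_{q_n}$ is the trivial bundle $E\times\mathbb C^n$ with its trivial metric $H_0$ and the holomorphic structure $$\bar\partial_{A_0}=\bar\partial-\frac{\pi Q}{\operatorname{Im}\tau}\,d\bar z,\qquad Q=\operatorname{diag}(\tilde q_1,\dots,\tilde q_n),$$ which acts on endomorphisms by $\bar\partial_{A_0}s=\bar\partial s-\frac{\pi}{\operatorname{Im}\tau}[Q,s]\,d\bar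 z$. Then there is a constant $C_p>0$, depending on $E$, $n$ and the $\tilde q_i$ but not on $s$, such that for every trace-free Hermitian endomorphism $s$ of $\mathcal E_0$ of class $C^1$ (in particular, for every smooth one) whose diagonal entries in the trivial frame satisfy $\int_E s_{ii}\,\omega_0=0$ for all $i$, $$\|s\|_{L^2(E)}\le C_p\,\|\bar\partial_{A_0}s\|_{L^2(E)},$$ where the norms are taken with respect to $g_0$ and $H_0$. -/

import Mathlib

open scoped ContDiff

noncomputable section

namespace FlatTorus

/-- The period lattice `ℤ + ℤ τ` in `ℂ`. -/
def lattice (τ : ℂ) : AddSubgroup ℂ := AddSubgroup.closure {1, τ}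

/-- The elliptic curve `E = ℂ / (ℤ + ℤ τ)` (used for `Im τ > 0`). -/
abbrev Curve (τ : ℂ) : Type := ℂ ⧸ lattice τ

/-- The point of `E` with real coordinates `(y¹, y²)`, that is, with complex coordinate
`z = y² + τ y¹`. -/
def point (τ : ℂ) (y : ℝ × ℝ) : Curve τ := (((y.2 : ℂ) + τ * (y.1 : ℂ) : ℂ) : Curve τ)

/-- The integral over `E` of a function against the Kähler form `ω₀ = dy¹ ∧ dy²`, which has total
mass one.  It is computed in the fundamental domain `0 ≤ y¹, y² ≤ 1`. -/
def integral {F : Type*} [NormedAddCommGroup F] [NormedSpace ℝ F] (τ : ℂ) (f : Curve τ → F) : F :=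
  ∫ y in Set.Icc (0 : ℝ) 1 ×ˢ Set.Icc (0 : ℝ) 1, f (point τ y)

/-- The coefficient `∂f/∂z̄ = (∂f/∂x + i ∂f/∂y) / 2` of `∂̄ f = (∂f/∂z̄) dz̄`, for a function `f`
on `E` and the coordinate `z = x + i y`.  Translation by `p` identifies a neighbourhood of `0`
in `ℂ` with a neighbourhood of `p` in `E`. -/
def dbar {τ : ℂ} (f : Curve τ → ℂ) (p : Curve τ) : ℂ :=
  (1 / 2 : ℂ) *
    (fderiv ℝ (fun z : ℂ => f (p + (z : Curve τ))) 0 1 +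
      Complex.I * fderiv ℝ (fun z : ℂ => f (p + (z : Curve τ))) 0 Complex.I)

/-- The endomorphisms of the trivial bundle `E × ℂⁿ`, written as matrices of functions on `E` in
the global frame. -/
abbrev Endo (τ : ℂ) (n : ℕ) : Type := Curve τ → Matrix (Fin n) (Fin n) ℂ

/-- The endomorphism is of class `Cᵏ` on `E`: the lifts of its entries to the universal cover `ℂ`
are of class `Cᵏ` in the real sense. -/
def Endo.IsContDiff {τ : ℂ} {n : ℕ} (k : ℕ∞) (s : Endo τ n) : Prop :=
  ∀ i j, ContDiff ℝ k (fun z : ℂ => s (z : Curve τ) i j)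

/-- The pointwise squared norm `|a|² = Tr (a a*)` for the trivial metric `H₀`. -/
def normSq {n : ℕ} (a : Matrix (Fin n) (Fin n) ℂ) : ℝ := ∑ i, ∑ j, ‖a i j‖ ^ 2

/-- The norm `‖s‖_{L²(E)}` of an endomorphism. -/
def l2Norm {τ : ℂ} {n : ℕ} (s : Endo τ n) : ℝ :=
  Real.sqrt (integral τ fun p => normSq (s p))

/-- The norm `‖a dz̄‖_{L²(E)}` of an endomorphism-valued `(0,1)`-form with coefficient `a`.
The flat metric with Kähler form `ω₀ = dy¹ ∧ dy²` is `g₀ = |dz|² / Im τ`, so the pointwise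
norm of `dz̄` is given by `|dz̄|² = 2 Im τ`. -/
def l2NormForm {τ : ℂ} {n : ℕ} (a : Endo τ n) : ℝ :=
  Real.sqrt (integral τ fun p => 2 * τ.im * normSq (a p))

/-- The coefficient of `dz̄` in `∂̄_{A₀} s`, where `A₀` is the connection with
`∂̄_{A₀} = ∂̄ - (π Q / Im τ) dz̄` on `E × ℂⁿ` and `Q` is the diagonal matrix with entries `qt i`.
On an endomorphism `s` this operator is `∂̄ s - (π / Im τ) [Q, s] dz̄`. -/
def dbarA {τ : ℂ} {n : ℕ} (qt : Fin n → ℂ) (s : Endo τ n) : Endo τ n := fun p =>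
  Matrix.of (fun i j => dbar (fun p' => s p' i j) p) -
    ((Real.pi / τ.im : ℝ) : ℂ) • (Matrix.diagonal qt * s p - s p * Matrix.diagonal qt)

end FlatTorus

end

/-!
The inequality is a spectral gap on the torus. The `(i, j)` entry of `∂̄_{A₀} s` is
`∂̄ s_{ij} - (π c / Im τ) s_{ij} dz̄` with `c = q̃_i - q̃_j`, so the entries decouple. In the real
coordinates `z = y² + τ y¹` one has `∂/∂z̄ = i / (2 Im τ) (∂/∂y¹ - τ ∂/∂y²)` (`dbar_point`), and
integration by parts against the character `exp (2πi (m y¹ + k y²))` shows that the twisted operator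
multiplies the Fourier coefficient of frequency `(m, k)` by `-(π / Im τ) (m - k τ + c)`
(`coeff_twistedDbar`).

The numbers `m - k τ + c` form a translate of the lattice, hence those that are not zero are bounded
away from zero (`exists_spectral_gap`). For `i ≠ j` none is zero, because `q_i ≠ q_j` on `E`. For
`i = j` only the frequency `(0, 0)` gives zero, and there the coefficient of `s_{ii}` is its mean,
which vanishes. Parseval's identity (`hasSum_sq_coeff`) turns the termwise bound into the inequality
for each entry (`exists_entry_bound`), and summation over the entries gives the result.
-/

noncomputable section

open MeasureTheory Set

namespace FlatTorus

-- The multivariate Fourier theory normalises the circle by its Haar probability measure.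
attribute [local instance] instMeasureSpaceUnitAddCircle

/-! ### The curve as a standard real torus -/

/-- The one-parameter subgroup `x ↦ x v` of `E` in the direction of a period `v`, as a homomorphism
from the circle `ℝ / ℤ`. -/
def periodHom (τ v : ℂ) (hv : v ∈ lattice τ) : UnitAddCircle →+ Curve τ :=
  QuotientAddGroup.lift (AddSubgroup.zmultiples (1 : ℝ))
    ((QuotientAddGroup.mk' (lattice τ)).comp (LinearMap.toSpanSingleton ℝ ℂ v).toAddMonoidHom)
    (by
      rw [AddSubgroup.zmultiples_le]
      simpa [AddMonoidHom.mem_ker] using hv)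

lemma periodHom_coe (τ v : ℂ) (hv : v ∈ lattice τ) (x : ℝ) :
    periodHom τ v hv (x : UnitAddCircle) = (((x : ℂ) * v : ℂ) : Curve τ) := by
  simp [periodHom]

lemma continuous_coe (τ : ℂ) : Continuous (fun z : ℂ => (z : Curve τ)) :=
  continuous_quot_mk

lemma continuous_periodHom (τ v : ℂ) (hv : v ∈ lattice τ) : Continuous (periodHom τ v hv) := by
  refine continuous_quot_lift _ ?_
  exact (continuous_coe τ).comp (by fun_prop : Continuous fun x : ℝ => x • v)

lemma one_mem_lattice (τ : ℂ) : (1 : ℂ) ∈ lattice τ := AddSubgroup.subset_closure (by simp)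

lemma self_mem_lattice (τ : ℂ) : τ ∈ lattice τ := AddSubgroup.subset_closure (by simp)

/-- The map `ℝ² / ℤ² → E` given by the real coordinates `(y¹, y²)`. -/
def ofTorus (τ : ℂ) (t : UnitAddTorus (Fin 2)) : Curve τ :=
  periodHom τ τ (self_mem_lattice τ) (t 0) + periodHom τ 1 (one_mem_lattice τ) (t 1)

lemma continuous_ofTorus (τ : ℂ) : Continuous (ofTorus τ) :=
  ((continuous_periodHom _ _ _).comp (continuous_apply 0)).add
    ((continuous_periodHom _ _ _).comp (continuous_apply 1))

lemma ofTorus_coe (τ : ℂ) (y : ℝ × ℝ) :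
    ofTorus τ ![(y.1 : UnitAddCircle), (y.2 : UnitAddCircle)] = point τ y := by
  simp only [ofTorus, Matrix.cons_val_zero, Matrix.cons_val_one, periodHom_coe, point]
  rw [← QuotientAddGroup.mk_add]
  congr 1
  ring

lemma continuous_point (τ : ℂ) : Continuous (point τ) :=
  (continuous_coe τ).comp (by fun_prop)

lemma setIntegral_unitSquare_eq_torus {F : Type*} [NormedAddCommGroup F] [NormedSpace ℝ F]
    (g : UnitAddTorus (Fin 2) → F) :
    ∫ y in Icc (0 : ℝ) 1 ×ˢ Icc (0 : ℝ) 1, g ![(y.1 : UnitAddCircle), (y.2 : UnitAddCircle)] =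
      ∫ t, g t := by
  rw [UnitAddTorus.integral_preimage g (fun _ => 0)]
  have hmp := (volume_preserving_finTwoArrow ℝ)
  have h := hmp.setIntegral_preimage_emb (MeasurableEquiv.measurableEmbedding _)
    (fun y : ℝ × ℝ => g ![(y.1 : UnitAddCircle), (y.2 : UnitAddCircle)])
    (Ioc (0 : ℝ) 1 ×ˢ Ioc (0 : ℝ) 1)
  have hae : (Icc (0 : ℝ) 1 ×ˢ Icc (0 : ℝ) 1 : Set (ℝ × ℝ)) =ᵐ[volume]
      (Ioc (0 : ℝ) 1 ×ˢ Ioc (0 : ℝ) 1 : Set (ℝ × ℝ)) :=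
    Measure.set_prod_ae_eq Ioc_ae_eq_Icc.symm Ioc_ae_eq_Icc.symm
  rw [setIntegral_congr_set hae, ← h]
  have hset : (MeasurableEquiv.finTwoArrow (α := ℝ)) ⁻¹' (Ioc (0 : ℝ) 1 ×ˢ Ioc (0 : ℝ) 1) =
      {x : Fin 2 → ℝ | ∀ i, x i ∈ Ioc (0 : ℝ) (0 + 1)} := by
    ext x
    simp [MeasurableEquiv.finTwoArrow, Fin.forall_fin_two]
  rw [hset]
  congr 1
  ext x
  congr 1
  ext i
  fin_cases i <;> rfl

lemma integral_eq_torus {F : Type*} [NormedAddCommGroup F] [NormedSpace ℝ F] (τ : ℂ)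
    (f : Curve τ → F) : integral τ f = ∫ t, f (ofTorus τ t) := by
  simp only [integral, ← ofTorus_coe]
  exact setIntegral_unitSquare_eq_torus (fun t => f (ofTorus τ t))

lemma integrableOn_unitSquare {F : Type*} [NormedAddCommGroup F] {g : ℝ × ℝ → F}
    (hg : Continuous g) : IntegrableOn g (Icc (0 : ℝ) 1 ×ˢ Icc (0 : ℝ) 1) :=
  hg.continuousOn.integrableOn_compact (isCompact_Icc.prod isCompact_Icc)

/-! ### Fourier coefficients -/

/-- The Fourier coefficient at the character `(y¹, y²) ↦ exp (2πi (m y¹ + k y²))`. -/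
def coeff {τ : ℂ} (f : Curve τ → ℂ) (n : Fin 2 → ℤ) : ℂ :=
  UnitAddTorus.mFourierCoeff (fun t => f (ofTorus τ t)) n

lemma coeff_eq_setIntegral {τ : ℂ} (f : Curve τ → ℂ) (n : Fin 2 → ℤ) :
    coeff f n = ∫ y in Icc (0 : ℝ) 1 ×ˢ Icc (0 : ℝ) 1,
      Complex.exp (-(2 * Real.pi * Complex.I * (n 0 * y.1 + n 1 * y.2))) * f (point τ y) := by
  rw [coeff, UnitAddTorus.mFourierCoeff, ← setIntegral_unitSquare_eq_torus]
  congr 1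
  ext y
  rw [ofTorus_coe, smul_eq_mul]
  congr 1
  simp only [UnitAddTorus.mFourier, ContinuousMap.coe_mk, Fin.prod_univ_two, Matrix.cons_val_zero,
    Matrix.cons_val_one, fourier_coe_apply, ← Complex.exp_add, Pi.neg_apply]
  congr 1
  push_cast
  ring

/-- Parseval's identity on `E`. -/
lemma hasSum_sq_coeff {τ : ℂ} {f : Curve τ → ℂ} (hf : Continuous f) :
    HasSum (fun n => ‖coeff f n‖ ^ 2) (integral τ fun p => ‖f p‖ ^ 2) := by
  have : IsProbabilityMeasure (volume : Measure UnitAddCircle) :=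
    inferInstanceAs (IsProbabilityMeasure AddCircle.haarAddCircle)
  let G : C(UnitAddTorus (Fin 2), ℂ) := ⟨fun t => f (ofTorus τ t), hf.comp (continuous_ofTorus τ)⟩
  have h := UnitAddTorus.hasSum_sq_mFourierCoeff (G.toLp 2 volume ℂ)
  simp only [UnitAddTorus.mFourierCoeff_toLp] at h
  rw [integral_eq_torus]
  have hG : ∫ t, ‖(G.toLp 2 volume ℂ) t‖ ^ 2 = ∫ t, ‖G t‖ ^ 2 := by
    refine integral_congr_ae ?_
    filter_upwards [G.coeFn_toLp (p := 2) (𝕜 := ℂ) volume] with t ht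
    rw [ht]
  rw [hG] at h
  exact h

/-! ### The Cauchy-Riemann operator on Fourier coefficients -/

lemma continuous_of_lift {τ : ℂ} {f : Curve τ → ℂ} (hf : Continuous fun z : ℂ => f z) :
    Continuous f :=
  (QuotientAddGroup.isQuotientMap_mk (N := lattice τ)).continuous_iff.2 hf

lemma dbar_coe {τ : ℂ} (f : Curve τ → ℂ) (z : ℂ) :
    dbar f (z : Curve τ) = (1 / 2 : ℂ) * (fderiv ℝ (fun w : ℂ => f w) z 1 +
      Complex.I * fderiv ℝ (fun w : ℂ => f w) z Complex.I) := by
  have h : (fun w : ℂ => f ((z : Curve τ) + (w : Curve τ))) =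
      fun w : ℂ => (fun u : ℂ => f (u : Curve τ)) (z + w) := by
    rfl
  have h' := fderiv_comp_add_left (𝕜 := ℝ) (f := fun u : ℂ => f (u : Curve τ)) (x := 0) z
  rw [dbar, h, h', add_zero]

lemma continuous_dbar {τ : ℂ} {f : Curve τ → ℂ} (hf : ContDiff ℝ 1 fun z : ℂ => f z) :
    Continuous (dbar f) := by
  refine continuous_of_lift ?_
  simp only [dbar_coe]
  have h := hf.continuous_fderiv one_ne_zero
  fun_prop

/-- In the real coordinates `z = y² + τ y¹`, the operator `∂/∂z̄` is
`i / (2 Im τ) (∂/∂y¹ - τ ∂/∂y²)`. -/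
lemma dbar_point {τ : ℂ} (hτ : 0 < τ.im) {f : Curve τ → ℂ}
    (hf : Differentiable ℝ fun z : ℂ => f z) (y : ℝ × ℝ) :
    dbar f (point τ y) = Complex.I / (2 * τ.im) *
      (fderiv ℝ (fun y => f (point τ y)) y (1, 0) -
        τ * fderiv ℝ (fun y => f (point τ y)) y (0, 1)) := by
  let L : ℝ × ℝ →L[ℝ] ℂ :=
    Complex.ofRealCLM.comp (ContinuousLinearMap.snd ℝ ℝ ℝ) +
      τ • Complex.ofRealCLM.comp (ContinuousLinearMap.fst ℝ ℝ ℝ)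
  have hL : ∀ y : ℝ × ℝ, L y = (y.2 : ℂ) + τ * (y.1 : ℂ) := fun y => by simp [L]
  have hd : fderiv ℝ (fun y => f (point τ y)) y =
      (fderiv ℝ (fun z : ℂ => f z) ((y.2 : ℂ) + τ * (y.1 : ℂ))).comp L := by
    have h := ((hf (L y)).hasFDerivAt.comp y L.hasFDerivAt).fderiv
    rw [hL] at h
    rw [← h]
    congr 1
  rw [hd, point, dbar_coe]
  set D := fderiv ℝ (fun z : ℂ => f z) ((y.2 : ℂ) + τ * (y.1 : ℂ))
  have h1 : D (L (1, 0)) = τ.re * D 1 + τ.im * D Complex.I := by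
    have : L (1, 0) = τ.re • (1 : ℂ) + τ.im • Complex.I := by
      rw [hL]
      simp [Complex.re_add_im]
    rw [this, map_add, map_smul, map_smul]
    simp
  have h2 : D (L (0, 1)) = D 1 := by
    rw [hL]; simp
  have him : (τ.im : ℂ) ≠ 0 := by exact_mod_cast hτ.ne'
  rw [ContinuousLinearMap.comp_apply, ContinuousLinearMap.comp_apply, h1, h2]
  nth_rewrite 4 [← Complex.re_add_im τ]
  field_simp
  linear_combination (τ.im * D 1) * Complex.I_sq

lemma setIntegral_deriv_eq_zero_of_periodic {H : ℝ × ℝ → ℂ} (hH : ContDiff ℝ 1 H)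
    (h1 : ∀ x, H (1, x) = H (0, x)) (h2 : ∀ x, H (x, 1) = H (x, 0)) (a b : ℂ) :
    ∫ y in Icc (0 : ℝ) 1 ×ˢ Icc (0 : ℝ) 1,
      (a * fderiv ℝ H y (1, 0) + b * fderiv ℝ H y (0, 1)) = 0 := by
  have hc := hH.continuous_fderiv one_ne_zero
  have hd := hH.differentiable one_ne_zero
  have hcH := hH.continuous
  have hset : (Icc (0 : ℝ) 1 ×ˢ Icc (0 : ℝ) 1 : Set (ℝ × ℝ)) = Icc ((0 : ℝ), (0 : ℝ)) (1, 1) :=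
    Icc_prod_Icc _ _ _ _
  have hi : IntegrableOn (fun y => a * fderiv ℝ H y (1, 0) + b * fderiv ℝ H y (0, 1))
      (Icc (0 : ℝ) 1 ×ˢ Icc (0 : ℝ) 1) := integrableOn_unitSquare (by fun_prop)
  have h := integral_divergence_prod_Icc_of_hasFDerivAt_of_le (fun y => a * H y)
    (fun y => b * H y) (fun y => a • fderiv ℝ H y) (fun y => b • fderiv ℝ H y)
    ((0 : ℝ), (0 : ℝ)) (1, 1) (by simp) (by fun_prop) (by fun_prop)
    (fun y _ => (hd y).hasFDerivAt.const_mul a) (fun y _ => (hd y).hasFDerivAt.const_mul b)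
    (by rw [← hset]; simpa using hi)
  rw [hset]
  simpa [h1, h2] using h

lemma point_add_period_fst (τ : ℂ) (x : ℝ) : point τ (1, x) = point τ (0, x) := by
  refine (QuotientAddGroup.eq).2 ?_
  simpa using neg_mem (self_mem_lattice τ)

lemma point_add_period_snd (τ : ℂ) (x : ℝ) : point τ (x, 1) = point τ (x, 0) := by
  refine (QuotientAddGroup.eq).2 ?_
  simpa using neg_mem (one_mem_lattice τ)

/-- Integration by parts against the character with frequency `(m, k)`. -/
lemma coeff_dbar {τ : ℂ} (hτ : 0 < τ.im) {f : Curve τ → ℂ}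
    (hf : ContDiff ℝ 1 fun z : ℂ => f z) (n : Fin 2 → ℤ) :
    coeff (dbar f) n = -(Real.pi / τ.im * (n 0 - τ * n 1)) * coeff f n := by
  have him : (τ.im : ℂ) ≠ 0 := by exact_mod_cast hτ.ne'
  let e : ℝ × ℝ → ℂ := fun y =>
    Complex.exp (-(2 * Real.pi * Complex.I * (n 0 * y.1 + n 1 * y.2)))
  let F : ℝ × ℝ → ℂ := fun y => f (point τ y)
  let L : ℝ × ℝ →L[ℝ] ℂ := (-(2 * Real.pi * Complex.I)) •
    ((n 0 : ℂ) • Complex.ofRealCLM.comp (ContinuousLinearMap.fst ℝ ℝ ℝ) +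
      (n 1 : ℂ) • Complex.ofRealCLM.comp (ContinuousLinearMap.snd ℝ ℝ ℝ))
  have heL : e = fun y => Complex.exp (L y) := by
    ext y
    simp only [e, L, smul_apply, add_apply,
      ContinuousLinearMap.comp_apply, ContinuousLinearMap.coe_fst', ContinuousLinearMap.coe_snd',
      Complex.ofRealCLM_apply, smul_eq_mul, neg_mul]
  have he : ContDiff ℝ 1 e := by
    rw [heL]
    exact L.contDiff.cexp
  have hF : ContDiff ℝ 1 F := by
    refine hf.comp (?_ : ContDiff ℝ 1 fun y : ℝ × ℝ => (y.2 : ℂ) + τ * (y.1 : ℂ))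
    have := Complex.ofRealCLM.contDiff (n := 1)
    exact (this.comp contDiff_snd).add (contDiff_const.mul (this.comp contDiff_fst))
  have hde : ∀ y, HasFDerivAt e (e y • L) y := fun y => by
    rw [heL]
    exact L.hasFDerivAt.cexp
  have hdF := hF.differentiable one_ne_zero
  have hprod : ∀ y v, fderiv ℝ (fun y => e y * F y) y v =
      e y * fderiv ℝ F y v + e y * L v * F y := fun y v => by
    have h : HasFDerivAt (fun y => e y * F y) _ y := (hde y).mul (hdF y).hasFDerivAt
    rw [h.fderiv]
    simp
    ring
  have hzero := setIntegral_deriv_eq_zero_of_periodic (H := fun y => e y * F y) (he.mul hF)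
    (fun x => by
      have : e (1, x) = e (0, x) := by
        refine Complex.exp_eq_exp_iff_exists_int.2 ⟨-n 0, ?_⟩
        push_cast
        ring
      simp only [F, this, point_add_period_fst])
    (fun x => by
      have : e (x, 1) = e (x, 0) := by
        refine Complex.exp_eq_exp_iff_exists_int.2 ⟨-n 1, ?_⟩
        push_cast
        ring
      simp only [F, this, point_add_period_snd])
    (Complex.I / (2 * τ.im)) (-(Complex.I / (2 * τ.im) * τ))
  have hL1 : L (1, 0) = -(2 * Real.pi * Complex.I) * n 0 := by simp [L]
  have hL2 : L (0, 1) = -(2 * Real.pi * Complex.I) * n 1 := by simp [L]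
  have hcdb : Continuous fun y => e y * dbar f (point τ y) :=
    he.continuous.mul ((continuous_dbar hf).comp (continuous_point τ))
  have hcF : Continuous fun y => Real.pi / τ.im * (n 0 - τ * n 1) * (e y * F y) :=
    continuous_const.mul (he.continuous.mul hF.continuous)
  have hsum : ∀ y, Complex.I / (2 * τ.im) * fderiv ℝ (fun y => e y * F y) y (1, 0) +
      -(Complex.I / (2 * τ.im) * τ) * fderiv ℝ (fun y => e y * F y) y (0, 1) =
      e y * dbar f (point τ y) + Real.pi / τ.im * (n 0 - τ * n 1) * (e y * F y) := fun y => by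
    rw [hprod, hprod, hL1, hL2, dbar_point hτ (hf.differentiable one_ne_zero)]
    field_simp
    linear_combination (-2 * Real.pi * (n 0 - n 1 * τ) * e y * F y) * Complex.I_sq
  simp only [hsum] at hzero
  rw [integral_add (integrableOn_unitSquare hcdb) (integrableOn_unitSquare hcF),
    integral_const_mul] at hzero
  rw [coeff_eq_setIntegral, coeff_eq_setIntegral]
  linear_combination hzero

/-- The coefficient of `dz̄` of `(∂̄ - (π c / Im τ) dz̄) f`. -/
def twistedDbar {τ : ℂ} (c : ℂ) (f : Curve τ → ℂ) (p : Curve τ) : ℂ :=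
  dbar f p - (Real.pi / τ.im : ℝ) * (c * f p)

lemma continuous_twistedDbar {τ : ℂ} (c : ℂ) {f : Curve τ → ℂ}
    (hf : ContDiff ℝ 1 fun z : ℂ => f z) : Continuous (twistedDbar c f) := by
  have h1 := continuous_dbar hf
  have h2 := continuous_of_lift hf.continuous
  unfold twistedDbar
  fun_prop

/-- The twisted operator is diagonalised by the characters, with the translated lattice
`{m - k τ + c}` as spectrum up to scale. -/
lemma coeff_twistedDbar {τ : ℂ} (hτ : 0 < τ.im) (c : ℂ) {f : Curve τ → ℂ}
    (hf : ContDiff ℝ 1 fun z : ℂ => f z) (n : Fin 2 → ℤ) :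
    coeff (twistedDbar c f) n = -(Real.pi / τ.im * (n 0 - τ * n 1 + c)) * coeff f n := by
  have h1 := continuous_dbar hf
  have h2 := continuous_of_lift hf.continuous
  have h3 := continuous_point τ
  have h : coeff (twistedDbar c f) n = coeff (dbar f) n - Real.pi / τ.im * c * coeff f n := by
    rw [coeff_eq_setIntegral, coeff_eq_setIntegral, coeff_eq_setIntegral, ← integral_const_mul,
      ← integral_sub (integrableOn_unitSquare (by fun_prop))
        (integrableOn_unitSquare (by fun_prop))]
    congr 1
    ext y
    simp only [twistedDbar]
    push_cast
    ring
  rw [h, coeff_dbar hτ hf]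
  ring

/-! ### The spectral gap -/

/-- A translate of the lattice stays away from the origin, apart from the origin itself. -/
lemma exists_spectral_gap {τ : ℂ} (hτ : 0 < τ.im) (c : ℂ) :
    ∃ δ : ℝ, 0 < δ ∧ ∀ n : Fin 2 → ℤ, (n 0 - τ * n 1 + c : ℂ) ≠ 0 →
      δ ≤ ‖(n 0 - τ * n 1 + c : ℂ)‖ := by
  let w : (Fin 2 → ℤ) → ℂ := fun n => n 0 - τ * n 1 + c
  have hfin : {n : Fin 2 → ℤ | ‖w n‖ < 1}.Finite := by
    obtain ⟨K, hK⟩ := exists_nat_ge ((1 + |c.im|) / τ.im)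
    obtain ⟨M, hM⟩ := exists_nat_ge (1 + |c.re| + |τ.re| * K)
    refine (Set.finite_Icc (![-M, -K] : Fin 2 → ℤ) ![M, K]).subset fun n hn => ?_
    have hre : |(n 0 : ℝ) - τ.re * n 1 + c.re| < 1 := by
      have := (Complex.abs_re_le_norm (w n)).trans_lt hn
      simpa [w] using this
    have him : |-(τ.im * n 1) + c.im| < 1 := by
      have := (Complex.abs_im_le_norm (w n)).trans_lt hn
      simpa [w] using this
    have hk : |(n 1 : ℝ)| ≤ K := by
      refine le_trans ?_ hK
      rw [le_div_iff₀ hτ]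
      have : |(n 1 : ℝ)| * τ.im = |c.im - (-(τ.im * n 1) + c.im)| := by
        rw [show c.im - (-(τ.im * n 1) + c.im) = n 1 * τ.im by ring, abs_mul, abs_of_pos hτ]
      rw [this]
      linarith [abs_sub c.im (-(τ.im * n 1) + c.im)]
    have hm : |(n 0 : ℝ)| ≤ M := by
      refine le_trans ?_ hM
      have h1 : (n 0 : ℝ) = ((n 0 : ℝ) - τ.re * n 1 + c.re) - c.re + τ.re * n 1 := by ring
      have h2 : |τ.re * n 1| ≤ |τ.re| * K := by
        rw [abs_mul]
        gcongr
      have h3 := abs_add_le (((n 0 : ℝ) - τ.re * n 1 + c.re) - c.re) (τ.re * n 1)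
      have h4 := abs_sub ((n 0 : ℝ) - τ.re * n 1 + c.re) c.re
      rw [← h1] at h3
      linarith
    rw [abs_le] at hk hm
    simp only [mem_Icc, Pi.le_def, Fin.forall_fin_two, Matrix.cons_val_zero, Matrix.cons_val_one]
    exact ⟨⟨by exact_mod_cast hm.1, by exact_mod_cast hk.1⟩,
      ⟨by exact_mod_cast hm.2, by exact_mod_cast hk.2⟩⟩
  have hfin' : ((fun n => ‖w n‖) '' {n | ‖w n‖ < 1 ∧ w n ≠ 0} ∪ {1}).Finite :=
    ((hfin.subset fun n hn => hn.1).image _).union (finite_singleton 1)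
  obtain ⟨δ, hδ, hmin⟩ := hfin'.exists_minimal ⟨1, Or.inr rfl⟩
  have hle : ∀ x ∈ (fun n => ‖w n‖) '' {n | ‖w n‖ < 1 ∧ w n ≠ 0} ∪ {1}, δ ≤ x := fun x hx =>
    (le_total δ x).elim id (fun h => hmin hx h)
  refine ⟨δ, ?_, fun n hn => ?_⟩
  · rcases hδ with ⟨n, hn, rfl⟩ | h
    · exact norm_pos_iff.2 hn.2
    · rw [h]; exact one_pos
  · by_cases h1 : ‖w n‖ < 1
    · exact hle _ (Or.inl ⟨n, ⟨h1, hn⟩, rfl⟩)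
    · exact (hle 1 (Or.inr rfl)).trans (not_lt.1 h1)

lemma coe_eq_zero_of_frequency_eq_zero {τ c : ℂ} {m k : ℤ} (h : (m - τ * k + c : ℂ) = 0) :
    (c : Curve τ) = 0 := by
  rw [QuotientAddGroup.eq_zero_iff]
  have : c = k • τ - m • (1 : ℂ) := by
    simp only [zsmul_eq_mul]
    linear_combination h
  rw [this]
  exact sub_mem (zsmul_mem (self_mem_lattice τ) _) (zsmul_mem (one_mem_lattice τ) _)

lemma frequency_eq_zero {τ : ℂ} (hτ : 0 < τ.im) {n : Fin 2 → ℤ}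
    (h : (n 0 - τ * n 1 : ℂ) = 0) : n = 0 := by
  have h1 : n 1 = 0 := by
    have := congrArg Complex.im h
    simpa [hτ.ne'] using this
  have h0 : n 0 = 0 := by simpa [h1] using h
  ext i
  fin_cases i
  · exact h0
  · exact h1

lemma coeff_zero {τ : ℂ} (f : Curve τ → ℂ) : coeff f 0 = integral τ f := by
  simp [coeff_eq_setIntegral, integral]

/-- The Poincaré inequality for one entry.  Either the kernel of the twisted operator is trivial,
or the kernel consists of constants, to which `f` is orthogonal. -/
lemma exists_entry_bound {τ : ℂ} (hτ : 0 < τ.im) (c : ℂ) :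
    ∃ C : ℝ, 0 ≤ C ∧ ∀ f : Curve τ → ℂ, ContDiff ℝ 1 (fun z : ℂ => f z) →
      ((c : Curve τ) ≠ 0 ∨ c = 0 ∧ integral τ f = 0) →
      integral τ (fun p => ‖f p‖ ^ 2) ≤
        C * integral τ (fun p => 2 * τ.im * ‖twistedDbar c f p‖ ^ 2) := by
  obtain ⟨δ, hδ, hgap⟩ := exists_spectral_gap hτ c
  -- Parseval bounds `∫ ‖f‖²` by `(Im τ / (π δ))² ∫ ‖D f‖²`; the form norm carries `2 Im τ`.
  refine ⟨(τ.im / (Real.pi * δ)) ^ 2 / (2 * τ.im), by positivity, fun f hf hc => ?_⟩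
  have hfc := continuous_of_lift hf.continuous
  have hR : integral τ (fun p => 2 * τ.im * ‖twistedDbar c f p‖ ^ 2) =
      2 * τ.im * integral τ (fun p => ‖twistedDbar c f p‖ ^ 2) := integral_const_mul _ _
  have hterm : ∀ n, ‖coeff f n‖ ^ 2 ≤
      (τ.im / (Real.pi * δ)) ^ 2 * ‖coeff (twistedDbar c f) n‖ ^ 2 := fun n => by
    rw [← mul_pow]
    refine pow_le_pow_left₀ (norm_nonneg _) ?_ 2
    by_cases hw : (n 0 - τ * n 1 + c : ℂ) = 0
    · have h0 : coeff f n = 0 := by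
        rcases hc with hc | ⟨rfl, hc⟩
        · exact absurd (coe_eq_zero_of_frequency_eq_zero hw) hc
        · rw [add_zero] at hw
          rw [frequency_eq_zero hτ hw, coeff_zero, hc]
      rw [h0, norm_zero]
      positivity
    · rw [coeff_twistedDbar hτ c hf, norm_mul, norm_neg, norm_mul, norm_div, Complex.norm_real,
        Complex.norm_real, Real.norm_of_nonneg Real.pi_pos.le, Real.norm_of_nonneg hτ.le]
      have h := hgap n hw
      have hpi := Real.pi_pos
      have : τ.im / (Real.pi * δ) *
          (Real.pi / τ.im * ‖(n 0 - τ * n 1 + c : ℂ)‖ * ‖coeff f n‖) =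
          ‖(n 0 - τ * n 1 + c : ℂ)‖ / δ * ‖coeff f n‖ := by
        field_simp
      rw [this]
      exact le_mul_of_one_le_left (norm_nonneg _) ((one_le_div hδ).2 h)
  have hle := hasSum_le hterm (hasSum_sq_coeff hfc)
    ((hasSum_sq_coeff (continuous_twistedDbar c hf)).mul_left _)
  rw [hR]
  refine hle.trans (le_of_eq ?_)
  field_simp

/-! ### Summation over the entries -/

lemma integral_normSq {τ : ℂ} {n : ℕ} {s : Endo τ n} (hs : ∀ i j, Continuous fun p => s p i j)
    (a : ℝ) : integral τ (fun p => a * normSq (s p)) =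
      ∑ i, ∑ j, integral τ (fun p => a * ‖s p i j‖ ^ 2) := by
  have hint : ∀ i j, IntegrableOn (fun y => a * ‖s (point τ y) i j‖ ^ 2)
      (Icc (0 : ℝ) 1 ×ˢ Icc (0 : ℝ) 1) := fun i j => by
    have h1 := (hs i j).comp (continuous_point τ)
    exact integrableOn_unitSquare (continuous_const.mul (h1.norm.pow 2))
  simp only [integral, normSq, Finset.mul_sum]
  rw [integral_finsetSum _ fun i _ => integrable_finsetSum _ fun j _ => hint i j]
  exact Finset.sum_congr rfl fun i _ => integral_finsetSum _ fun j _ => hint i j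

lemma dbarA_apply {τ : ℂ} {n : ℕ} (qt : Fin n → ℂ) (s : Endo τ n) (p : Curve τ) (i j : Fin n) :
    dbarA qt s p i j = twistedDbar (qt i - qt j) (fun p => s p i j) p := by
  simp only [dbarA, twistedDbar, Matrix.sub_apply, Matrix.of_apply, Matrix.smul_apply,
    Matrix.diagonal_mul, Matrix.mul_diagonal, smul_eq_mul]
  ring

end FlatTorus

end

theorem proposition6p2 (τ : ℂ) (hτ : 0 < τ.im) (n : ℕ)
    (q : Fin n → FlatTorus.Curve τ) (hq : Function.Injective q)
    (qt : Fin n → ℂ) (hqt : ∀ i, (qt i : FlatTorus.Curve τ) = q i) :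
    ∃ C : ℝ, 0 < C ∧ ∀ s : FlatTorus.Endo τ n,
      s.IsContDiff 1 →
      (∀ p, (s p).IsHermitian) →
      (∀ p, (s p).trace = 0) →
      (∀ i, FlatTorus.integral τ (fun p => s p i i) = 0) →
      FlatTorus.l2Norm s ≤ C * FlatTorus.l2NormForm (FlatTorus.dbarA qt s) := by
  choose C hC hbound using fun i j => FlatTorus.exists_entry_bound hτ (qt i - qt j)
  have hsum : 0 ≤ ∑ i, ∑ j, C i j :=
    Finset.sum_nonneg fun i _ => Finset.sum_nonneg fun j _ => hC i j
  -- The extra `1` keeps the constant positive when `n = 0`.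
  refine ⟨Real.sqrt (∑ i, ∑ j, C i j + 1), Real.sqrt_pos.2 (by positivity),
    fun s hs _ _ hmean => ?_⟩
  have hs1 : ∀ i j, ContDiff ℝ 1 fun z : ℂ => s z i j := hs
  have hle : ∀ i j, C i j ≤ ∑ i, ∑ j, C i j + 1 := fun i j => by
    have h1 := Finset.single_le_sum (fun j _ => hC i j) (Finset.mem_univ j)
    have h2 := Finset.single_le_sum (f := fun i => ∑ j, C i j)
      (fun i _ => Finset.sum_nonneg fun j _ => hC i j) (Finset.mem_univ i)
    linarith
  rw [FlatTorus.l2Norm, FlatTorus.l2NormForm, ← Real.sqrt_mul (by positivity)]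
  refine Real.sqrt_le_sqrt ?_
  have hL := FlatTorus.integral_normSq
    (fun i j => FlatTorus.continuous_of_lift (hs1 i j).continuous) 1
  simp only [one_mul] at hL
  rw [hL, FlatTorus.integral_normSq (fun i j => by
    simpa only [FlatTorus.dbarA_apply] using FlatTorus.continuous_twistedDbar _ (hs1 i j)),
    Finset.mul_sum]
  refine Finset.sum_le_sum fun i _ => ?_
  rw [Finset.mul_sum]
  refine Finset.sum_le_sum fun j _ => ?_
  simp only [FlatTorus.dbarA_apply]
  refine (hbound i j _ (hs1 i j) ?_).trans (mul_le_mul_of_nonneg_right (hle i j) ?_)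
  · by_cases hij : i = j
    · subst hij
      exact Or.inr ⟨sub_self _, hmean i⟩
    · refine Or.inl fun h => hij (hq ?_)
      rw [QuotientAddGroup.mk_sub, hqt, hqt, sub_eq_zero] at h
      exact h
  · exact MeasureTheory.integral_nonneg fun y => by positivity
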